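/- Let $(\mathsf Y_i)_{i\ge 1}$ and $(\mathsf Z_i)_{i\ge 1}$ be real-valued stochastic processes on a common probability space (arbitrary, possibly dependent, with arbitrary distributions) and let $\lambda\in[0,1]$. For $n\in\mathbb N$ put $\ell=\lfloor\lambda n\rfloor$ and let $$\mathsf x=[\mathsf Y_1\ \cdots\ \mathsf Y_{n-\ell}\ \ \mathsf Z_1\ \cdots\ \mathsf Z_\ell]^{\mathsf T}\in\mathbb R^n$$ be the concatenated source vector. For a nonempty bounded set $S\subseteq\mathbb R^n$ let $N_S(\delta)$ be the least number of open Euclidean balls of radius $\delta$, with centers in $\mathbb R^n$, that cover $S$, and define the lower Minkowski dimension $$\underline{\dim}_{\mathrm B}(S)=\liminf_{\delta\to0^+}\frac{\log N_S(\delta)}{\log(1/\delta)}.$$ For $\varepsilon>0$ define the lower Minkowski dimension compression rate $$\underline R_{\mathrm B}(\varepsilon)=\limsup_{n\to\infty}\ \inf\Big\{\tfrac1n\,\underline{\dim}_{\mathrm B}(S)\ :\ S\subseteq\mathbb R^n \text{ nonempty, bounded and Borel},\ \mathbb P[\mathsf x\in S]\ge 1-\varepsilon\Big\}.$$ **Theorem.**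 Let $\varepsilon>0$ and let $R\in\mathbb R$ satisfy $R>\underline R_{\mathrm B}(\varepsilon)$. Then there is an $N\in\mathbb N$, which does not depend on the matrices $A$ and $B$ below, such that for all $n\ge N$, with $k=\lfloor Rn\rfloor$, the following holds whenever $k\ge\ell$. For every full-rank matrix $B\in\mathbb R^{k\times\ell}$ (that is, $\operatorname{rank}B=\ell$) and for Lebesgue-almost every matrix $A\in\mathbb R^{k\times(n-\ell)}$ (the exceptional null set may depend on $B$), there exists a Borel measurable map (separator) $g:\mathbb R^k\to\mathbb R^{n-\ell}\times\mathbb R^{\ell}$ such that $$\mathbb P\big[g([A\ \,B]\,\mathsf x)\ne\mathsf x\big]\le\varepsilon .$$ -/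

import Mathlib

open Filter MeasureTheory
open scoped Topology

noncomputable section

/-- The covering number `N_S(δ)`: the least number of open balls of radius `δ`, with arbitrary
centers in the ambient space, that cover `S`. -/
def coveringNumber {E : Type*} [PseudoMetricSpace E] (S : Set E) (δ : ℝ) : ℕ :=
  sInf {m : ℕ | ∃ c : Fin m → E, S ⊆ ⋃ i, Metric.ball (c i) δ}

/-- The lower Minkowski (box-counting) dimension
`liminf_{δ → 0+} log N_S(δ) / log (1/δ)`, with the liminf taken in the extended reals.
It is used for nonempty bounded sets of a Euclidean space only. -/
def lowerMinkowskiDim {E : Type*} [PseudoMetricSpace E] (S : Set E) : EReal :=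
  liminf (fun δ : ℝ => ((Real.log (coveringNumber S δ) / Real.log (1 / δ) : ℝ) : EReal))
    (𝓝[>] (0 : ℝ))

/-- The length `ℓ = ⌊λ n⌋` of the second block of the source vector of dimension `n`. -/
def blockLen (lam : ℝ) (n : ℕ) : ℕ := ⌊lam * n⌋₊

/-- The index set of a vector of dimension `n` that consists of a block of length `n - ℓ`
followed by a block of length `ℓ = ⌊λ n⌋`. -/
abbrev BlockIdx (lam : ℝ) (n : ℕ) : Type := Fin (n - blockLen lam n) ⊕ Fin (blockLen lam n)

/-- The concatenated source vector `[Y₁ … Y_{n-ℓ} Z₁ … Z_ℓ]ᵀ` of dimension `n`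
(the processes are indexed from `0` here). -/
def sourceVector {Ω : Type*} (Y Z : ℕ → Ω → ℝ) (lam : ℝ) (n : ℕ) (ω : Ω) :
    EuclideanSpace ℝ (BlockIdx lam n) :=
  WithLp.toLp 2 (Sum.elim (fun i => Y i ω) (fun i => Z i ω))

/-- The quantity `a_n(ε)`: the infimum of `dim_B(S) / n` (lower Minkowski dimension) over the
nonempty bounded Borel sets `S` in dimension `n` that contain the source vector with
probability at least `1 - ε`. -/
def lowerDimRatio {Ω : Type*} [MeasurableSpace Ω] (P : Measure Ω) (Y Z : ℕ → Ω → ℝ)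
    (lam ε : ℝ) (n : ℕ) : EReal :=
  sInf {a : EReal | ∃ S : Set (EuclideanSpace ℝ (BlockIdx lam n)),
    S.Nonempty ∧ Bornology.IsBounded S ∧ MeasurableSet S ∧
    1 - ε ≤ P.real {ω | sourceVector Y Z lam n ω ∈ S} ∧
    a = lowerMinkowskiDim S / (n : EReal)}

/-- The lower Minkowski dimension compression rate `limsup_{n → ∞} a_n(ε)`. -/
def lowerCompressionRate {Ω : Type*} [MeasurableSpace Ω] (P : Measure Ω) (Y Z : ℕ → Ω → ℝ)
    (lam ε : ℝ) : EReal :=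
  limsup (fun n : ℕ => lowerDimRatio P Y Z lam ε n) atTop

/-- The noiseless linear measurement `[A B] x = A y + B z` of `x = [y; z]`. -/
def measurement {lam : ℝ} {n k : ℕ} (A : Fin k → Fin (n - blockLen lam n) → ℝ)
    (B : Matrix (Fin k) (Fin (blockLen lam n)) ℝ) (x : EuclideanSpace ℝ (BlockIdx lam n)) :
    EuclideanSpace ℝ (Fin k) :=
  WithLp.toLp 2 (Matrix.mulVec (Matrix.fromCols (Matrix.of A) B) x.ofLp)

end

/-!
Fix `n` and a bounded set `S` of lower Minkowski dimension `< k` that carries the source vector with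
probability at least `1 - ε`, and let `K = closure S`. Fix `x = (y, z) ∈ K`. A matrix `A` confuses
`x` with another point `x' = (y', z') ∈ K` when `A (y' - y) + B (z' - z) = 0`; since `B` is
injective, `y' ≠ y`. For a given `x'`, each of the `k` independent rows of `A` is then confined to a
slab, so that the bounded matrices that confuse `x` with some point of a `δ`-ball have measure
`O(δ ^ k)`, uniformly over the points with `‖y' - y‖ ≥ d`. At arbitrarily small scales `δ` the set
`K` is covered by `δ ^ (-s)` balls with `s < k`, and the total `O(δ ^ (k - s))` tends to zero. Hence
almost every `A` leaves `x` unconfused. By Fubini, almost every `A` leaves almost every realisation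
of the source in `K` unconfused, and on the Borel set of unconfused points the measurement is
injective and therefore has a Borel left inverse.
-/

open scoped Matrix

section Covering

variable {E : Type*} [PseudoMetricSpace E] {K S : Set E} {s δ : ℝ}

/-- At arbitrarily small scales `δ > 0`, the set `K` is covered by at most `δ ^ (-s)` closed balls
of radius `δ`. This is the only consequence of `lowerMinkowskiDim K < s` that the argument uses;
the balls are closed so that the property passes to the closure of `K` at the same scales. -/
def HasFrequentCovers (K : Set E) (s : ℝ) : Prop :=
  ∃ᶠ δ in 𝓝[>] (0 : ℝ), ∃ (m : ℕ) (c : Fin m → E),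
    K ⊆ ⋃ i, Metric.closedBall (c i) δ ∧ (m : ℝ) ≤ δ ^ (-s)

theorem HasFrequentCovers.mono (hK : HasFrequentCovers K s) (hSK : S ⊆ K) :
    HasFrequentCovers S s :=
  Frequently.mono hK fun _ ⟨m, c, hc, hm⟩ => ⟨m, c, hSK.trans hc, hm⟩

theorem HasFrequentCovers.closure (hK : HasFrequentCovers K s) :
    HasFrequentCovers (closure K) s :=
  Frequently.mono hK fun _ ⟨m, c, hc, hm⟩ =>
    ⟨m, c, closure_minimal hc (isClosed_iUnion_of_finite fun _ => Metric.isClosed_closedBall), hm⟩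

theorem exists_subset_iUnion_ball_coveringNumber (hS : TotallyBounded S) (hδ : 0 < δ) :
    ∃ c : Fin (coveringNumber S δ) → E, S ⊆ ⋃ i, Metric.ball (c i) δ := by
  refine Nat.sInf_mem (s := {m : ℕ | ∃ c : Fin m → E, S ⊆ ⋃ i, Metric.ball (c i) δ}) ?_
  obtain ⟨t, ht, hcov⟩ := Metric.totallyBounded_iff.1 hS δ hδ
  have := ht.fintype
  let e := Fintype.equivFin t
  refine ⟨Fintype.card t, fun i => e.symm i, hcov.trans (Set.iUnion₂_subset fun y hy => ?_)⟩
  exact Set.subset_iUnion_of_subset (e ⟨y, hy⟩) (by simp only [e.symm_apply_apply, subset_rfl])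

theorem coveringNumber_pos (hne : S.Nonempty) (hS : TotallyBounded S) (hδ : 0 < δ) :
    0 < coveringNumber S δ := by
  obtain ⟨c, hc⟩ := exists_subset_iUnion_ball_coveringNumber hS hδ
  obtain ⟨x, hx⟩ := hne
  obtain ⟨i, -⟩ := Set.mem_iUnion.1 (hc hx)
  exact i.pos

theorem hasFrequentCovers_of_lowerMinkowskiDim_lt (hne : S.Nonempty) (hS : TotallyBounded S)
    (h : lowerMinkowskiDim S < (s : EReal)) : HasFrequentCovers S s := by
  have hfreq := frequently_lt_of_liminf_lt (by isBoundedDefault) h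
  refine (hfreq.and_eventually (Ioo_mem_nhdsGT one_pos)).mono ?_
  rintro δ ⟨hlt, hδ0, hδ1⟩
  obtain ⟨c, hc⟩ := exists_subset_iUnion_ball_coveringNumber hS hδ0
  refine ⟨_, c, hc.trans (Set.iUnion_mono fun i => Metric.ball_subset_closedBall), ?_⟩
  have hpos : (0 : ℝ) < coveringNumber S δ := mod_cast coveringNumber_pos hne hS hδ0
  have hlog : 0 < Real.log (1 / δ) := Real.log_pos (one_lt_one_div hδ0 hδ1)
  rw [EReal.coe_lt_coe_iff, div_lt_iff₀ hlog, one_div, Real.log_inv] at hlt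
  rw [← Real.log_le_log_iff hpos (Real.rpow_pos_of_pos hδ0 _), Real.log_rpow hδ0]
  linarith

theorem tendsto_const_mul_ofReal_rpow_nhdsGT_zero {C : ENNReal} (hC : C ≠ ⊤) {p : ℝ} (hp : 0 < p) :
    Tendsto (fun δ : ℝ => C * ENNReal.ofReal (δ ^ p)) (𝓝[>] 0) (𝓝 0) := by
  have hpow : Tendsto (fun δ : ℝ => δ ^ p) (𝓝[>] 0) (𝓝 0) := by
    have h := (Real.continuousAt_rpow_const 0 p (Or.inr hp.le)).tendsto
    rw [Real.zero_rpow hp.ne'] at h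
    exact h.mono_left nhdsWithin_le_nhds
  simpa using ENNReal.Tendsto.const_mul (ENNReal.tendsto_ofReal hpow) (Or.inr hC)

theorem measure_biUnion_eq_zero_of_hasFrequentCovers {α : Type*} [MeasurableSpace α]
    {μ : Measure α} {V : E → Set α} {p : ℝ} {C : ENNReal} (hK : HasFrequentCovers K s)
    (hsp : s < p) (hC : C ≠ ⊤)
    (hV : ∀ c δ, 0 < δ → μ (⋃ x ∈ K ∩ Metric.closedBall c δ, V x) ≤ C * ENNReal.ofReal (δ ^ p)) :
    μ (⋃ x ∈ K, V x) = 0 := by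
  have hlim := tendsto_const_mul_ofReal_rpow_nhdsGT_zero hC (sub_pos.2 hsp)
  refine le_antisymm (le_of_forall_gt fun b hb => ?_) zero_le
  obtain ⟨δ, ⟨⟨m, c, hcov, hm⟩, hδb⟩, hδ : 0 < δ⟩ := ((hK.and_eventually
    (hlim.eventually_lt_const hb)).and_eventually self_mem_nhdsWithin).exists
  have hsub : ⋃ x ∈ K, V x ⊆ ⋃ i, ⋃ x ∈ K ∩ Metric.closedBall (c i) δ, V x := by
    refine Set.iUnion₂_subset fun x hx => ?_
    obtain ⟨i, hi⟩ := Set.mem_iUnion.1 (hcov hx)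
    exact Set.subset_iUnion_of_subset i (Set.subset_biUnion_of_mem ⟨hx, hi⟩)
  calc μ (⋃ x ∈ K, V x)
      ≤ ∑ i, μ (⋃ x ∈ K ∩ Metric.closedBall (c i) δ, V x) :=
        (measure_mono hsub).trans (measure_iUnion_fintype_le _ _)
    _ ≤ ∑ _i : Fin m, C * ENNReal.ofReal (δ ^ p) := Finset.sum_le_sum fun i _ => hV _ _ hδ
    _ = ENNReal.ofReal m * (C * ENNReal.ofReal (δ ^ p)) := by simp
    _ ≤ ENNReal.ofReal (δ ^ (-s)) * (C * ENNReal.ofReal (δ ^ p)) := by gcongr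
    _ = C * ENNReal.ofReal (δ ^ (p - s)) := by
        rw [mul_left_comm, ← ENNReal.ofReal_mul (by positivity), ← Real.rpow_add hδ,
          neg_add_eq_sub]
    _ < b := hδb

end Covering

section Slab

variable {ι m : Type*} [Fintype ι]

theorem exists_norm_apply_eq_norm [Nonempty ι] {F : Type*} [SeminormedAddCommGroup F] (v : ι → F) :
    ∃ j, ‖v j‖ = ‖v‖ := by
  obtain ⟨j, hj⟩ := Finite.exists_max fun i => ‖v i‖
  exact ⟨j, (norm_le_pi_norm v j).antisymm ((pi_norm_le_iff_of_nonempty v).2 hj)⟩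

theorem det_one_updateRow [DecidableEq ι] {R : Type*} [CommRing R] (j : ι) (v : ι → R) :
    ((1 : Matrix ι ι R).updateRow j v).det = v j := by
  rw [← Matrix.cramer_transpose_apply, Matrix.transpose_one, Matrix.cramer_one]
  rfl

theorem one_updateRow_mulVec [DecidableEq ι] {R : Type*} [CommSemiring R] (j : ι) (v a : ι → R) :
    (1 : Matrix ι ι R).updateRow j v *ᵥ a = Function.update a j (a ⬝ᵥ v) := by
  ext i
  rcases eq_or_ne i j with rfl | hi
  · simp [Matrix.mulVec, dotProduct_comm]
  · simp [Matrix.mulVec, dotProduct, Matrix.one_apply, hi]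

theorem volume_univ_pi_update_const [DecidableEq ι] {X : Type*} [MeasureSpace X]
    [SigmaFinite (volume : Measure X)] (j : ι) (I J : Set X) :
    volume (Set.pi Set.univ (Function.update (fun _ : ι => I) j J)) =
      volume J * volume I ^ (Fintype.card ι - 1) := by
  rw [volume_pi_pi, ← Finset.mul_prod_erase _ _ (Finset.mem_univ j), Function.update_self,
    Finset.prod_congr rfl (g := fun _ => volume I) fun i hi => by
      rw [Function.update_of_ne (Finset.ne_of_mem_erase hi)],
    Finset.prod_const, Finset.card_erase_of_mem (Finset.mem_univ j), Finset.card_univ]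

theorem volume_closedBall_inter_abs_dotProduct_add_le {v : ι → ℝ} (hv : v ≠ 0) (b : ℝ) {r : ℝ}
    (hr : 0 ≤ r) (η : ℝ) :
    volume (Metric.closedBall 0 r ∩ {a : ι → ℝ | |a ⬝ᵥ v + b| ≤ η}) ≤
      ENNReal.ofReal (2 * η * ((2 * r) ^ (Fintype.card ι - 1) / ‖v‖)) := by
  classical
  have : Nonempty ι := (Function.ne_iff.1 hv).nonempty
  obtain ⟨j, hj⟩ := exists_norm_apply_eq_norm v
  rw [Real.norm_eq_abs] at hj
  have hvj : v j ≠ 0 := by rwa [← abs_ne_zero, hj, norm_ne_zero_iff]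
  set T : (ι → ℝ) →ₗ[ℝ] (ι → ℝ) := Matrix.toLin' ((1 : Matrix ι ι ℝ).updateRow j v) with hT
  have hdet : LinearMap.det T = v j := by rw [hT, LinearMap.det_toLin', det_one_updateRow]
  have hsub : Metric.closedBall 0 r ∩ {a : ι → ℝ | |a ⬝ᵥ v + b| ≤ η} ⊆ T ⁻¹' Set.pi Set.univ
      (Function.update (fun _ => Set.Icc (-r) r) j (Set.Icc (-b - η) (-b + η))) := by
    rintro a ⟨har, hab⟩ i -
    rw [mem_closedBall_zero_iff, pi_norm_le_iff_of_nonneg hr] at har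
    rw [hT, Matrix.toLin'_apply, one_updateRow_mulVec]
    rcases eq_or_ne i j with rfl | hi
    · have := abs_le.1 (Set.mem_ofPred.1 hab)
      simp only [Function.update_self, Set.mem_Icc]
      constructor <;> linarith
    · simpa only [Function.update_of_ne hi, Set.mem_Icc] using abs_le.1 (har i)
  refine (measure_mono hsub).trans_eq ?_
  rw [Measure.addHaar_preimage_linearMap _ (by rwa [hdet]), hdet,
    volume_univ_pi_update_const, Real.volume_Icc, Real.volume_Icc, abs_inv, hj, mul_comm,
    ← ENNReal.ofReal_pow (by linarith), ← ENNReal.ofReal_mul' (pow_nonneg (by linarith) _),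
    ← ENNReal.ofReal_mul' (by positivity)]
  congr 1; ring

variable [Fintype m]

theorem volume_closedBall_inter_norm_mulVec_add_le {u : ι → ℝ} (hu : u ≠ 0) (b : m → ℝ) {r : ℝ}
    (hr : 0 ≤ r) {η : ℝ} (hη : 0 ≤ η) :
    volume (Metric.closedBall 0 r ∩ {A : m → ι → ℝ | ‖Matrix.of A *ᵥ u + b‖ ≤ η}) ≤
      ENNReal.ofReal (2 * η * ((2 * r) ^ (Fintype.card ι - 1) / ‖u‖)) ^ Fintype.card m := by
  have hsub : Metric.closedBall 0 r ∩ {A : m → ι → ℝ | ‖Matrix.of A *ᵥ u + b‖ ≤ η} ⊆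
      Set.pi Set.univ fun i => Metric.closedBall 0 r ∩ {a | |a ⬝ᵥ u + b i| ≤ η} := by
    rintro A ⟨hAr, hAη⟩ i -
    rw [mem_closedBall_zero_iff] at hAr
    exact ⟨mem_closedBall_zero_iff.2 ((norm_le_pi_norm A i).trans hAr),
      (pi_norm_le_iff_of_nonneg hη).1 hAη i⟩
  refine (measure_mono hsub).trans ?_
  rw [volume_pi_pi, ← Finset.card_univ]
  exact Finset.prod_le_pow_card _ _ _ fun i _ =>
    volume_closedBall_inter_abs_dotProduct_add_le hu (b i) hr η

theorem norm_mulVec_le_card_mul (A : m → ι → ℝ) (w : ι → ℝ) :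
    ‖Matrix.of A *ᵥ w‖ ≤ Fintype.card ι * ‖A‖ * ‖w‖ := by
  refine (pi_norm_le_iff_of_nonneg (by positivity)).2 fun i => ?_
  calc ‖∑ j, A i j * w j‖ ≤ ∑ j, ‖A i j * w j‖ := norm_sum_le _ _
    _ ≤ ∑ _j : ι, ‖A‖ * ‖w‖ := Finset.sum_le_sum fun j _ => (norm_mul_le _ _).trans <| by
        gcongr
        exacts [(norm_le_pi_norm (A i) j).trans (norm_le_pi_norm A i), norm_le_pi_norm w j]
    _ = Fintype.card ι * ‖A‖ * ‖w‖ := by simp [mul_assoc]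

end Slab

section NullSet

variable {ι m E : Type*} [Fintype ι] [Fintype m] {K : Set E} {s : ℝ}

section Lipschitz

variable [PseudoMetricSpace E] {u : E → ι → ℝ} {v : E → m → ℝ} {L M : NNReal}

theorem norm_mulVec_add_sub_le {x y : E} (hu : LipschitzOnWith L u K) (hv : LipschitzOnWith M v K)
    {A : m → ι → ℝ} {r : ℝ} (hA : ‖A‖ ≤ r) (hx : x ∈ K) (hy : y ∈ K) :
    ‖Matrix.of A *ᵥ u x + v x - (Matrix.of A *ᵥ u y + v y)‖ ≤
      (Fintype.card ι * r * L + M) * dist x y := by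
  have hr : 0 ≤ r := (norm_nonneg A).trans hA
  calc ‖Matrix.of A *ᵥ u x + v x - (Matrix.of A *ᵥ u y + v y)‖
      = ‖Matrix.of A *ᵥ (u x - u y) + (v x - v y)‖ := by
        rw [add_sub_add_comm, Matrix.mulVec_sub]
    _ ≤ Fintype.card ι * ‖A‖ * ‖u x - u y‖ + ‖v x - v y‖ :=
        (norm_add_le _ _).trans (by gcongr; exact norm_mulVec_le_card_mul A _)
    _ ≤ Fintype.card ι * r * (L * dist x y) + M * dist x y := by
        gcongr
        exacts [(dist_eq_norm _ _).symm.trans_le (hu.dist_le_mul x hx y hy),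
          (dist_eq_norm _ _).symm.trans_le (hv.dist_le_mul x hx y hy)]
    _ = (Fintype.card ι * r * L + M) * dist x y := by ring

theorem volume_biUnion_closedBall_inter_mulVec_add_eq_zero_le (hu : LipschitzOnWith L u K)
    (hv : LipschitzOnWith M v K) {d r : ℝ} (hd : 0 < d) (hr : 0 ≤ r) (hdu : ∀ x ∈ K, d ≤ ‖u x‖)
    (c : E) {δ : ℝ} (hδ : 0 ≤ δ) :
    volume (⋃ x ∈ K ∩ Metric.closedBall c δ,
        Metric.closedBall 0 r ∩ {A : m → ι → ℝ | Matrix.of A *ᵥ u x + v x = 0}) ≤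
      ENNReal.ofReal (2 * ((Fintype.card ι * r * L + M) * (2 * δ)) *
        ((2 * r) ^ (Fintype.card ι - 1) / d)) ^ Fintype.card m := by
  rcases (K ∩ Metric.closedBall c δ).eq_empty_or_nonempty with hempty | ⟨w, hwK, hwc⟩
  · simp [hempty]
  have hsub : ⋃ x ∈ K ∩ Metric.closedBall c δ,
      Metric.closedBall 0 r ∩ {A : m → ι → ℝ | Matrix.of A *ᵥ u x + v x = 0} ⊆
      Metric.closedBall 0 r ∩ {A : m → ι → ℝ | ‖Matrix.of A *ᵥ u w + v w‖ ≤
        (Fintype.card ι * r * L + M) * (2 * δ)} := by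
    refine Set.iUnion₂_subset fun x ⟨hxK, hxc⟩ A ⟨hAr, hAx⟩ => ⟨hAr, ?_⟩
    have hlip := norm_mulVec_add_sub_le hu hv (mem_closedBall_zero_iff.1 hAr) hwK hxK
    rw [show Matrix.of A *ᵥ u x + v x = 0 from hAx, sub_zero] at hlip
    have hwx : dist w x ≤ 2 * δ := by
      linarith [dist_triangle_right w x c, Metric.mem_closedBall.1 hwc, Metric.mem_closedBall.1 hxc]
    exact hlip.trans (by gcongr)
  have hw : d ≤ ‖u w‖ := hdu w hwK
  refine (measure_mono hsub).trans ((volume_closedBall_inter_norm_mulVec_add_le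
    (norm_pos_iff.1 (hd.trans_le hw)) (v w) hr (by positivity)).trans ?_)
  gcongr

theorem volume_biUnion_closedBall_inter_mulVec_add_eq_zero (hu : LipschitzOnWith L u K)
    (hv : LipschitzOnWith M v K) (hK : HasFrequentCovers K s) (hs : s < Fintype.card m) {d r : ℝ}
    (hd : 0 < d) (hr : 0 ≤ r) (hdu : ∀ x ∈ K, d ≤ ‖u x‖) :
    volume (⋃ x ∈ K,
      Metric.closedBall 0 r ∩ {A : m → ι → ℝ | Matrix.of A *ᵥ u x + v x = 0}) = 0 := by
  set C : ℝ := 4 * (Fintype.card ι * r * L + M) * ((2 * r) ^ (Fintype.card ι - 1) / d)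
  refine measure_biUnion_eq_zero_of_hasFrequentCovers (C := ENNReal.ofReal C ^ Fintype.card m)
    hK hs (by finiteness) fun c δ hδ => ?_
  refine (volume_biUnion_closedBall_inter_mulVec_add_eq_zero_le hu hv hd hr hdu c hδ.le).trans_eq ?_
  rw [Real.rpow_natCast, ENNReal.ofReal_pow hδ.le, ← mul_pow, ← ENNReal.ofReal_mul' hδ.le]
  congr 2; ring

theorem ae_forall_mulVec_add_eq_zero_imp (hu : LipschitzOnWith L u K) (hv : LipschitzOnWith M v K)
    (hK : HasFrequentCovers K s) (hs : s < Fintype.card m) :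
    ∀ᵐ A : m → ι → ℝ, ∀ x ∈ K, Matrix.of A *ᵥ u x + v x = 0 → u x = 0 := by
  have hnull (r p : ℕ) : ∀ᵐ A : m → ι → ℝ, A ∉ ⋃ x ∈ {x ∈ K | 1 / ((p : ℝ) + 1) ≤ ‖u x‖},
      Metric.closedBall 0 (r : ℝ) ∩ {A : m → ι → ℝ | Matrix.of A *ᵥ u x + v x = 0} :=
    measure_eq_zero_iff_ae_notMem.1 <| volume_biUnion_closedBall_inter_mulVec_add_eq_zero
      (hu.mono (Set.sep_subset _ _)) (hv.mono (Set.sep_subset _ _))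
      (hK.mono (Set.sep_subset _ _)) hs (by positivity) (by positivity) fun x hx => hx.2
  simp only [← ae_all_iff] at hnull
  filter_upwards [hnull] with A hA x hx hAx
  by_contra hux
  obtain ⟨p, hp⟩ := exists_nat_one_div_lt (norm_pos_iff.2 hux)
  obtain ⟨r, hr⟩ := exists_nat_ge ‖A‖
  exact hA r p (Set.mem_biUnion ⟨hx, hp.le⟩ ⟨mem_closedBall_zero_iff.2 hr, hAx⟩)

end Lipschitz

theorem ae_forall_mulVec_add_eq_imp_eq [NormedAddCommGroup E] [NormedSpace ℝ E]
    {p : E →L[ℝ] ι → ℝ} {q : E →L[ℝ] m → ℝ} (hpq : ∀ z, p z = 0 → q z = 0 → z = 0)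
    (hK : HasFrequentCovers K s) (hs : s < Fintype.card m) (x : E) :
    ∀ᵐ A : m → ι → ℝ, ∀ x' ∈ K,
      Matrix.of A *ᵥ p x' + q x' = Matrix.of A *ᵥ p x + q x → x' = x := by
  filter_upwards [ae_forall_mulVec_add_eq_zero_imp
    (p.lipschitz.comp (LipschitzWith.id.sub (.const x))).lipschitzOnWith
    (q.lipschitz.comp (LipschitzWith.id.sub (.const x))).lipschitzOnWith hK hs] with A hA x' hx' heq
  have hdiff : Matrix.of A *ᵥ p (x' - x) + q (x' - x) = 0 := by
    rw [map_sub, map_sub, Matrix.mulVec_sub, ← add_sub_add_comm, heq, sub_self]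
  have hp : p (x' - x) = 0 := hA x' hx' hdiff
  rw [hp, Matrix.mulVec_zero, zero_add] at hdiff
  exact sub_eq_zero.1 (hpq _ hp hdiff)

end NullSet

section Separator

theorem exists_measurable_leftInvOn {E β : Type*} [TopologicalSpace E] [PolishSpace E] [Nonempty E]
    [MeasurableSpace E] [BorelSpace E] [TopologicalSpace β] [T2Space β] [MeasurableSpace β]
    [BorelSpace β] {f : E → β} {G : Set E} (hG : MeasurableSet G) (hf : ContinuousOn f G)
    (hinj : Set.InjOn f G) :
    ∃ g : β → E, Measurable g ∧ Set.LeftInvOn g f G := by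
  obtain ⟨g, hg, hgG⟩ := (hf.measurableEmbedding hG hinj).exists_measurable_extend
    measurable_subtype_coe fun _ => inferInstance
  exact ⟨g, hg, fun x hx => congrFun hgG ⟨x, hx⟩⟩

variable {α E β : Type*} [TopologicalSpace α] [MetricSpace E] [TopologicalSpace β] [T2Space β]
  {F : α → E → β} {K : Set E}

/-- The pairs `(a, x)` with `x ∈ K` for which the observation `F a x` does not determine `x` among
the points of `K`. -/
def ambiguousPairs (F : α → E → β) (K : Set E) : Set (α × E) :=
  {q | q.2 ∈ K ∧ ∃ x' ∈ K, F q.1 x' = F q.1 q.2 ∧ x' ≠ q.2}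

-- Separating `x'` from `x` by at least `1 / (p + 1)` makes the condition closed, and projecting
-- along the compact set `K` preserves closedness.
theorem measurableSet_ambiguousPairs [MeasurableSpace (α × E)] [OpensMeasurableSpace (α × E)]
    (hF : Continuous (Function.uncurry F)) (hK : IsCompact K) :
    MeasurableSet (ambiguousPairs F K) := by
  have : CompactSpace K := isCompact_iff_compactSpace.1 hK
  have heq : ambiguousPairs F K = {q | q.2 ∈ K} ∩ ⋃ p : ℕ, Prod.fst '' {t : (α × E) × K |
      1 / ((p : ℝ) + 1) ≤ dist (t.2 : E) t.1.2 ∧ F t.1.1 t.2 = F t.1.1 t.1.2} := by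
    ext q
    simp only [ambiguousPairs, Set.mem_ofPred_eq, Set.mem_inter_iff, Set.mem_iUnion, Set.mem_image]
    refine and_congr_right fun _ => ⟨?_, ?_⟩
    · rintro ⟨x', hx', h, hne⟩
      obtain ⟨p, hp⟩ := exists_nat_one_div_lt (dist_pos.2 hne)
      exact ⟨p, (q, ⟨x', hx'⟩), ⟨hp.le, h⟩, rfl⟩
    · rintro ⟨p, ⟨q', x'⟩, ⟨hp, h⟩, rfl⟩
      exact ⟨x', x'.2, h, dist_pos.1 (Nat.one_div_pos_of_nat.trans_le hp)⟩
  rw [heq]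
  refine (hK.isClosed.preimage continuous_snd).measurableSet.inter
    (MeasurableSet.iUnion fun p => (isClosedMap_fst_of_compactSpace _ ?_).measurableSet)
  exact (isClosed_le continuous_const
    ((continuous_subtype_val.comp continuous_snd).dist (by fun_prop))).inter (isClosed_eq
    (hF.comp (f := fun t : (α × E) × K => (t.1.1, (t.2 : E))) (by fun_prop))
    (hF.comp continuous_fst))

variable [MeasurableSpace α] [OpensMeasurableSpace α] [PolishSpace E] [MeasurableSpace E]
  [BorelSpace E] [MeasurableSpace β] [BorelSpace β]

theorem exists_measurable_separator [Nonempty E] (hF : Continuous (Function.uncurry F))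
    (hK : IsCompact K) (a : α) :
    ∃ g : β → E, Measurable g ∧ ∀ x ∈ K, (a, x) ∉ ambiguousPairs F K → g (F a x) = x := by
  have hG : MeasurableSet (K \ Prod.mk a ⁻¹' ambiguousPairs F K) := hK.measurableSet.diff
    (measurable_prodMk_left (measurableSet_ambiguousPairs hF hK))
  have hinj : Set.InjOn (F a) (K \ Prod.mk a ⁻¹' ambiguousPairs F K) := by
    rintro x ⟨hx, -⟩ y ⟨hy, hya⟩ hxy
    by_contra hne
    exact hya ⟨hy, x, hx, hxy, hne⟩
  have hFa : Continuous (F a) := by fun_prop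
  obtain ⟨g, hg, hgG⟩ := exists_measurable_leftInvOn hG hFa.continuousOn hinj
  exact ⟨g, hg, fun x hx hxa => hgG ⟨hx, hxa⟩⟩

theorem ae_exists_measurable_separator [Nonempty E] {Ω : Type*} [MeasurableSpace Ω]
    {P : Measure Ω} [SFinite P] {X : Ω → E} {ν : Measure α} [SFinite ν]
    (hF : Continuous (Function.uncurry F)) (hK : IsCompact K) (hX : Measurable X)
    (hsep : ∀ x ∈ K, ∀ᵐ a ∂ν, ∀ x' ∈ K, F a x' = F a x → x' = x) :
    ∀ᵐ a ∂ν, ∃ g : β → E, Measurable g ∧ P {ω | g (F a (X ω)) ≠ X ω} ≤ P {ω | X ω ∉ K} := by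
  have hfubini : ∀ᵐ a ∂ν, ∀ᵐ ω ∂P, (a, X ω) ∉ ambiguousPairs F K := by
    rw [Measure.ae_ae_comm (p := fun a ω => (a, X ω) ∉ ambiguousPairs F K)
      ((measurable_fst.prodMk (hX.comp measurable_snd)) (measurableSet_ambiguousPairs hF hK)).compl]
    refine ae_of_all _ fun ω => ?_
    by_cases hω : X ω ∈ K
    · filter_upwards [hsep _ hω] with a ha
      rintro ⟨-, x', hx', heq, hne⟩
      exact hne (ha x' hx' heq)
    · exact ae_of_all _ fun a ha => hω ha.1
  filter_upwards [hfubini] with a ha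
  obtain ⟨g, hg, hgK⟩ := exists_measurable_separator hF hK a
  refine ⟨g, hg, measure_mono_ae ?_⟩
  filter_upwards [ha] with ω hω hne hωK
  exact hne (hgK _ hωK hω)

end Separator

section Measurement

variable {Ω : Type*} [MeasurableSpace Ω] {P : Measure Ω} {Y Z : ℕ → Ω → ℝ} {lam : ℝ} {n k : ℕ}

theorem measurable_sourceVector (hY : ∀ i, Measurable (Y i)) (hZ : ∀ i, Measurable (Z i))
    (lam : ℝ) (n : ℕ) : Measurable (sourceVector Y Z lam n) := by
  refine (WithLp.measurable_toLp 2 _).comp (measurable_pi_lambda _ ?_)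
  rintro (i | i)
  exacts [hY i, hZ i]

theorem continuous_uncurry_measurement (B : Matrix (Fin k) (Fin (blockLen lam n)) ℝ) :
    Continuous (Function.uncurry fun (A : Fin k → Fin (n - blockLen lam n) → ℝ) =>
      measurement A B) := by
  refine (PiLp.continuous_toLp 2 _).comp ?_
  simp only [Matrix.fromCols_mulVec]
  fun_prop

theorem mulVec_injective_of_rank_eq_card {m κ 𝕜 : Type*} [Fintype κ] [Field 𝕜]
    {B : Matrix m κ 𝕜} (hB : B.rank = Fintype.card κ) : Function.Injective B.mulVec := by
  rw [Matrix.mulVec_injective_iff, linearIndependent_iff_card_eq_finrank_span, Set.finrank,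
    ← Matrix.rank_eq_finrank_span_cols, hB]

theorem ae_forall_measurement_eq_imp_eq {B : Matrix (Fin k) (Fin (blockLen lam n)) ℝ}
    (hB : B.rank = blockLen lam n) {K : Set (EuclideanSpace ℝ (BlockIdx lam n))} {s : ℝ}
    (hK : HasFrequentCovers K s) (hs : s < k) (x : EuclideanSpace ℝ (BlockIdx lam n)) :
    ∀ᵐ A : Fin k → Fin (n - blockLen lam n) → ℝ, ∀ x' ∈ K,
      measurement A B x' = measurement A B x → x' = x := by
  let p : EuclideanSpace ℝ (BlockIdx lam n) →L[ℝ] Fin (n - blockLen lam n) → ℝ :=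
    ContinuousLinearMap.pi fun j => EuclideanSpace.proj (Sum.inl j)
  let z : EuclideanSpace ℝ (BlockIdx lam n) →L[ℝ] Fin (blockLen lam n) → ℝ :=
    ContinuousLinearMap.pi fun l => EuclideanSpace.proj (Sum.inr l)
  let q := B.mulVecLin.toContinuousLinearMap ∘L z
  have hmeas (A : Fin k → Fin (n - blockLen lam n) → ℝ) (w : EuclideanSpace ℝ (BlockIdx lam n)) :
      measurement A B w = WithLp.toLp 2 (Matrix.of A *ᵥ p w + q w) := by
    rw [measurement, Matrix.fromCols_mulVec]
    rfl
  have hBinj : Function.Injective B.mulVec :=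
    mulVec_injective_of_rank_eq_card (by rw [hB, Fintype.card_fin])
  have hpq (w) (hp : p w = 0) (hq : q w = 0) : w = 0 := by
    have hz : z w = 0 := hBinj (hq.trans (Matrix.mulVec_zero B).symm)
    refine PiLp.ext ?_
    rintro (j | l)
    exacts [congrFun hp j, congrFun hz l]
  filter_upwards [ae_forall_mulVec_add_eq_imp_eq hpq hK (by rwa [Fintype.card_fin]) x]
    with A hA x' hx' heq
  rw [hmeas, hmeas] at heq
  exact hA x' hx' (WithLp.toLp_injective 2 heq)

theorem ae_exists_measurable_separator_of_lowerMinkowskiDim_lt [SFinite P]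
    {X : Ω → EuclideanSpace ℝ (BlockIdx lam n)} (hX : Measurable X)
    {B : Matrix (Fin k) (Fin (blockLen lam n)) ℝ} (hB : B.rank = blockLen lam n)
    {S : Set (EuclideanSpace ℝ (BlockIdx lam n))} (hne : S.Nonempty)
    (hS : Bornology.IsBounded S) (hdim : lowerMinkowskiDim S < (k : EReal)) :
    ∀ᵐ A : Fin k → Fin (n - blockLen lam n) → ℝ,
      ∃ g : EuclideanSpace ℝ (Fin k) → EuclideanSpace ℝ (BlockIdx lam n), Measurable g ∧
        P {ω | g (measurement A B (X ω)) ≠ X ω} ≤ P {ω | X ω ∉ closure S} := by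
  obtain ⟨s, hSs, hsk⟩ := EReal.exists_between_coe_real hdim
  have hcov : HasFrequentCovers (closure S) s :=
    (hasFrequentCovers_of_lowerMinkowskiDim_lt hne
      (hS.isCompact_closure.totallyBounded.subset subset_closure) hSs).closure
  exact ae_exists_measurable_separator (continuous_uncurry_measurement B) hS.isCompact_closure hX
    fun x _ => ae_forall_measurement_eq_imp_eq hB hcov (by exact_mod_cast hsk) x

end Measurement

section Rate

variable {Ω : Type*} [MeasurableSpace Ω] {P : Measure Ω} {Y Z : ℕ → Ω → ℝ} {lam ε R : ℝ}

theorem eventually_mul_natCast_lt_floor_mul {a b : ℝ} (hab : a < b) :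
    ∀ᶠ n : ℕ in atTop, a * n < ⌊b * n⌋₊ := by
  have hgap : Tendsto (fun n : ℕ => (b - a) * n) atTop atTop :=
    tendsto_natCast_atTop_atTop.const_mul_atTop (sub_pos.2 hab)
  filter_upwards [hgap.eventually_ge_atTop 1] with n hn
  linarith [Nat.sub_one_lt_floor (b * n)]

theorem eventually_exists_lowerMinkowskiDim_lt_floor
    (hR : lowerCompressionRate P Y Z lam ε < (R : EReal)) :
    ∀ᶠ n : ℕ in atTop, ∃ S : Set (EuclideanSpace ℝ (BlockIdx lam n)),
      S.Nonempty ∧ Bornology.IsBounded S ∧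
      1 - ε ≤ P.real {ω | sourceVector Y Z lam n ω ∈ S} ∧
      lowerMinkowskiDim S < (⌊R * n⌋₊ : EReal) := by
  obtain ⟨R', hR', hR'R⟩ := EReal.exists_between_coe_real hR
  filter_upwards [eventually_lt_of_limsup_lt hR' (by isBoundedDefault), eventually_gt_atTop 0,
    eventually_mul_natCast_lt_floor_mul (EReal.coe_lt_coe_iff.1 hR'R)] with n hratio hn hfloor
  obtain ⟨_, ⟨S, hne, hS, -, hSP, rfl⟩, hlt⟩ := sInf_lt_iff.1 hratio
  refine ⟨S, hne, hS, hSP, ?_⟩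
  rw [EReal.div_lt_iff (by exact_mod_cast hn) (EReal.natCast_ne_top n)] at hlt
  exact hlt.trans (by exact_mod_cast hfloor)

end Rate

theorem theorem1 {Ω : Type*} [MeasurableSpace Ω] (P : Measure Ω) [IsProbabilityMeasure P]
    (Y Z : ℕ → Ω → ℝ) (hY : ∀ i, Measurable (Y i)) (hZ : ∀ i, Measurable (Z i))
    (lam : ℝ) (hlam : lam ∈ Set.Icc (0 : ℝ) 1) (ε : ℝ) (hε : 0 < ε)
    (R : ℝ) (hR : lowerCompressionRate P Y Z lam ε < (R : EReal)) :
    ∃ N : ℕ, ∀ n : ℕ, N ≤ n → ∀ k : ℕ, k = ⌊R * n⌋₊ → blockLen lam n ≤ k →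
      ∀ B : Matrix (Fin k) (Fin (blockLen lam n)) ℝ, B.rank = blockLen lam n →
        ∀ᵐ A : Fin k → Fin (n - blockLen lam n) → ℝ ∂volume,
          ∃ g : EuclideanSpace ℝ (Fin k) → EuclideanSpace ℝ (BlockIdx lam n),
            Measurable g ∧
            P.real {ω | g (measurement A B (sourceVector Y Z lam n ω)) ≠
              sourceVector Y Z lam n ω} ≤ ε := by
  obtain ⟨N, hN⟩ := eventually_atTop.1 (eventually_exists_lowerMinkowskiDim_lt_floor hR)
  refine ⟨N, fun n hn k hk _ B hB => ?_⟩
  subst hk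
  obtain ⟨S, hne, hS, hSP, hdim⟩ := hN n hn
  have hX := measurable_sourceVector hY hZ lam n
  filter_upwards [ae_exists_measurable_separator_of_lowerMinkowskiDim_lt (P := P) hX hB hne hS hdim]
    with A ⟨g, hg, hgP⟩
  refine ⟨g, hg, ?_⟩
  have hmono : P.real {ω | sourceVector Y Z lam n ω ∈ S} ≤
      P.real {ω | sourceVector Y Z lam n ω ∈ closure S} :=
    measureReal_mono fun ω hω => subset_closure hω
  have hmiss : P.real {ω | sourceVector Y Z lam n ω ∉ closure S} =
      1 - P.real {ω | sourceVector Y Z lam n ω ∈ closure S} :=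
    probReal_compl_eq_one_sub (hX isClosed_closure.measurableSet)
  calc P.real {ω | g (measurement A B (sourceVector Y Z lam n ω)) ≠ sourceVector Y Z lam n ω}
      ≤ P.real {ω | sourceVector Y Z lam n ω ∉ closure S} :=
        ENNReal.toReal_mono (measure_ne_top _ _) hgP
    _ ≤ ε := by linarith
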